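/- Let $H$ be the real Hilbert space of $2\pi$-periodic, mean-zero, divergence-free fields $u\in L^2([0,2\pi]^2;\mathbb R^2)$, $u(x)=\sum_{k\in\mathbb Z^2\setminus\{0\}}\hat u(k)e^{ik\cdot x}$ with $k\cdot\hat u(k)=0$. Let $A$ be the Stokes operator, $\widehat{Au}(k)=|k|^2\hat u(k)$, with domain $D(A)=\{u\in H:\sum_k|k|^4|\hat u(k)|^2<\infty\}$, and let $B$ be the inertial term, $$\hat B(u,v)(k)=i\sum_{j\in\mathbb Z^2\setminus\{0\}}\Big[(\hat u(k-j)\cdot j)\,\hat v(j)-\frac{(\hat u(k-j)\cdot j)(\hat v(j)\cdot k)}{k\cdot k}\,k\Big],\qquad k\in\mathbb Z^2\setminus\{0\},\ u,v\in D(A).$$ For $g\in H$ consider the two-dimensional Navier--Stokes equation $$\frac{du}{dt}+Au+B(u,u)=g\quad\text{in }H, \qquad (*)$$ where a solution on $\mathbb R$ is a map $u:\mathbb R\to H$, differentiable in the norm of $H$, with $u(t)\in D(A)$ and $(*)$ for every $t\in\mathbb R$. The global attractor $\mathcal A\subset H$ is the set of all $u(0)$, where $u$ is a solution on $\mathbb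 R$ with $\sup_{t\in\mathbb R}|u(t)|<\infty$ ($|\cdot|$ is the $L^2$ norm). A ghost solution is a solution $u$ on $\mathbb R$ that is not constant in time, with $u(t)\in\mathcal A$ for all $t$, whose energy $e(t)=|u(t)|^2$ and enstrophy $E(t)=|A^{1/2}u(t)|^2$ satisfy $\dot e(t)=\dot E(t)=0$ for all $t\in\mathbb R$. A ghost solution is called chained if there are real constants $\gamma,\beta,\alpha$, independent of time, such that $$A^2u(t)=\gamma g+\beta u(t)+\alpha Au(t)\qquad\text{for all }t\in\mathbb R.$$ **Theorem.** Let $g\in H$, $g\neq0$, be an eigenvector of the Stokes operator with eigenvalue $\lambda=2$, that is, $Ag=2g$. Then no chained ghost solution of $(*)$ exists. -/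

import Mathlib

open MeasureTheory

noncomputable section

/-! ## The space-periodic setting

The period is `2π`. A point `x` of the periodic box `[0, 2π]²` is written `x = 2π y` with `y` in the
unit torus `(ℝ/ℤ)²`, so that `exp (2π i k · y) = exp (i k · x)` and `dx = (2π)² dy`. All Fourier
symbols below are those of derivatives with respect to `x`. -/

/-- The Haar probability measure on `(ℝ/ℤ)²`. -/
abbrev torusMeasure : Measure (UnitAddTorus (Fin 2)) :=
  Measure.pi fun _ => AddCircle.haarAddCircle

/-- Square integrable `ℝ²`-valued periodic vector fields. -/
abbrev PeriodicL2 : Type :=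
  Lp (EuclideanSpace ℝ (Fin 2)) 2 torusMeasure

/-- The Fourier coefficient `û(k) ∈ ℂ²`, so that `u(x) = ∑ₖ û(k) exp (i k · x)`. -/
def fourierVec (u : PeriodicL2) (k : Fin 2 → ℤ) : EuclideanSpace ℂ (Fin 2) :=
  WithLp.toLp 2 fun i => UnitAddTorus.mFourierCoeff (fun x => ((u x i : ℝ) : ℂ)) k

/-- The bilinear (not sesquilinear) product `k · z = k₁ z₁ + k₂ z₂` of `k ∈ ℤ²` and `z ∈ ℂ²`. -/
def waveDot (k : Fin 2 → ℤ) (z : EuclideanSpace ℂ (Fin 2)) : ℂ :=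
  (k 0 : ℂ) * z 0 + (k 1 : ℂ) * z 1

/-- The wave vector `k ∈ ℤ²` as an element of `ℂ²`. -/
def waveVec (k : Fin 2 → ℤ) : EuclideanSpace ℂ (Fin 2) :=
  WithLp.toLp 2 fun i => (k i : ℂ)

/-- `|k|² = k · k`. -/
def waveSq (k : Fin 2 → ℤ) : ℝ :=
  (k 0 : ℝ) ^ 2 + (k 1 : ℝ) ^ 2

theorem fourierVec_apply (u : PeriodicL2) (k : Fin 2 → ℤ) (i : Fin 2) :
    fourierVec u k i =
      ∫ x, UnitAddTorus.mFourier (-k) x * ((u x i : ℝ) : ℂ) ∂torusMeasure :=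
  rfl

theorem integrable_component (u : PeriodicL2) (i : Fin 2) :
    Integrable (fun x => ((u x i : ℝ) : ℂ)) torusMeasure := by
  have h : Integrable u torusMeasure := (Lp.memLp u).integrable (by norm_num)
  exact ((EuclideanSpace.proj (𝕜 := ℝ) i).integrable_comp h).ofReal

theorem integrable_mFourier_component (u : PeriodicL2) (i : Fin 2) (k : Fin 2 → ℤ) :
    Integrable (fun x => UnitAddTorus.mFourier (-k) x * ((u x i : ℝ) : ℂ)) torusMeasure := by
  refine (integrable_component u i).bdd_mul (c := 1) ?_ ?_
  · exact (UnitAddTorus.mFourier (-k)).continuous.aestronglyMeasurable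
  · exact Filter.Eventually.of_forall fun x => by
      simpa [UnitAddTorus.mFourier_norm] using (UnitAddTorus.mFourier (-k)).norm_coe_le_norm x

theorem fourierVec_add (u v : PeriodicL2) (k : Fin 2 → ℤ) :
    fourierVec (u + v) k = fourierVec u k + fourierVec v k := by
  ext i
  rw [PiLp.add_apply, fourierVec_apply, fourierVec_apply, fourierVec_apply,
    ← integral_add (integrable_mFourier_component u i k) (integrable_mFourier_component v i k)]
  refine integral_congr_ae ?_
  filter_upwards [Lp.coeFn_add u v] with x hx
  rw [hx, Pi.add_apply, PiLp.add_apply, Complex.ofReal_add, mul_add]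

theorem fourierVec_smul (c : ℝ) (u : PeriodicL2) (k : Fin 2 → ℤ) :
    fourierVec (c • u) k = (c : ℂ) • fourierVec u k := by
  ext i
  rw [PiLp.smul_apply, fourierVec_apply, fourierVec_apply, smul_eq_mul, ← integral_const_mul]
  refine integral_congr_ae ?_
  filter_upwards [Lp.coeFn_smul c u] with x hx
  rw [hx, Pi.smul_apply, PiLp.smul_apply, smul_eq_mul, Complex.ofReal_mul, mul_left_comm]

theorem fourierVec_zero (k : Fin 2 → ℤ) : fourierVec 0 k = 0 := by
  simpa using fourierVec_smul 0 0 k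

/-- The phase space `H`: square integrable periodic real vector fields of mean zero that are
divergence free, `k · û(k) = 0`. The reality condition holds because the fields are `ℝ²`-valued. -/
def PhaseSpace : Submodule ℝ PeriodicL2 where
  carrier := {u | fourierVec u 0 = 0 ∧ ∀ k, waveDot k (fourierVec u k) = 0}
  zero_mem' := ⟨fourierVec_zero 0, fun k => by simp [fourierVec_zero, waveDot]⟩
  add_mem' := by
    rintro u v ⟨hu, hu'⟩ ⟨hv, hv'⟩
    refine ⟨by simp [fourierVec_add, hu, hv], fun k => ?_⟩
    have h1 := hu' k
    have h2 := hv' k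
    simp only [waveDot, fourierVec_add, PiLp.add_apply] at *
    linear_combination h1 + h2
  smul_mem' := by
    rintro c u ⟨hu, hu'⟩
    refine ⟨by simp [fourierVec_smul, hu], fun k => ?_⟩
    have h1 := hu' k
    simp only [waveDot, fourierVec_smul, PiLp.smul_apply, smul_eq_mul] at *
    linear_combination (c : ℂ) * h1

/-- `IsStokes u v` says that `u` is in the domain of the Stokes operator `A` and `A u = v`, that is,
`v ∈ H` and `v̂(k) = |k|² û(k)` for all `k`. For `u ∈ H` such a `v ∈ H` exists exactly if
`∑ₖ |k|⁴ |û(k)|² < ∞`, and it is unique. -/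
def IsStokes (u v : PhaseSpace) : Prop :=
  ∀ k : Fin 2 → ℤ, fourierVec v k = (waveSq k : ℂ) • fourierVec u k

/-- The `j`-th term of the series for the `k`-th Fourier coefficient of `B(u, v)`:
`i [ (û(k-j) · j) v̂(j) - ((û(k-j) · j) (v̂(j) · k) / (k · k)) k ]`. It vanishes for `j = 0`. -/
def inertialTerm (u v : PhaseSpace) (k j : Fin 2 → ℤ) : EuclideanSpace ℂ (Fin 2) :=
  Complex.I •
    (waveDot j (fourierVec u (k - j)) • fourierVec v j -
      (waveDot j (fourierVec u (k - j)) * waveDot k (fourierVec v j) / (waveSq k : ℂ)) • waveVec k)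

/-- `IsInertial u v w` says that `B(u, v) = w`, where `B` is the inertial term, the Leray projection
of `(u · ∇) v`, given by its Fourier coefficients. -/
def IsInertial (u v w : PhaseSpace) : Prop :=
  ∀ k : Fin 2 → ℤ, k ≠ 0 → HasSum (inertialTerm u v k) (fourierVec w k)

/-- `u` is a solution, for all times `t ∈ ℝ`, of `du/dt + A u + B(u, u) = g` in `H`: at each time `u`
is in the domain of `A` and differentiable with respect to the norm of `H`. -/
def IsSolution (g : PhaseSpace) (u : ℝ → PhaseSpace) : Prop :=
  ∀ t : ℝ, ∃ a b : PhaseSpace,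
    IsStokes (u t) a ∧ IsInertial (u t) (u t) b ∧ HasDerivAt u (g - a - b) t

/-- The global attractor: the initial values of the solutions that are defined for all `t ∈ ℝ` and
bounded in `H`. -/
def globalAttractor (g : PhaseSpace) : Set PhaseSpace :=
  {u₀ | ∃ u : ℝ → PhaseSpace, IsSolution g u ∧ u 0 = u₀ ∧ ∃ M : ℝ, ∀ t, ‖u t‖ ≤ M}

/-- The energy `|u|² = ∫ |u(x)|² dx` over `[0, 2π]²`. -/
def energy (u : PhaseSpace) : ℝ :=
  (2 * Real.pi) ^ 2 * ‖u‖ ^ 2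

/-- The enstrophy `‖u‖² = |A^(1/2) u|² = (2π)² ∑ₖ |k|² |û(k)|²`, for `u` in the domain of `A^(1/2)`. -/
def enstrophy (u : PhaseSpace) : ℝ :=
  (2 * Real.pi) ^ 2 * ∑' k : Fin 2 → ℤ, waveSq k * ‖fourierVec u k‖ ^ 2

/-- A ghost solution: a nonstationary solution in the global attractor along which the energy and
the enstrophy have time derivative identically zero. -/
structure IsGhostSolution (g : PhaseSpace) (u : ℝ → PhaseSpace) : Prop where
  isSolution : IsSolution g u
  mem_attractor : ∀ t, u t ∈ globalAttractor g
  nonstationary : ¬ ∃ v : PhaseSpace, ∀ t, u t = v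
  energy_deriv : ∀ t, HasDerivAt (fun s => energy (u s)) 0 t
  enstrophy_deriv : ∀ t, HasDerivAt (fun s => enstrophy (u s)) 0 t

/-- A chained ghost solution: a ghost solution with `A² u(t) = γ g + β u(t) + α A u(t)` for all `t`,
with constants `γ`, `β`, `α` independent of time. -/
structure IsChainedGhostSolution (g : PhaseSpace) (u : ℝ → PhaseSpace) : Prop where
  isGhost : IsGhostSolution g u
  chained : ∃ γ β α : ℝ, ∀ t, ∃ a : PhaseSpace,
    IsStokes (u t) a ∧ IsStokes a (γ • g + β • u t + α • a)

end

/-! Off the shell `|k|² = 2` the force vanishes, so the chain relation confines every `u(t)` to that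
shell and to the shells whose `|k|²` is a root of `x² = α x + β`. These are finitely many modes, at
most three shells.

The nonlinear term conserves energy and enstrophy. As both are stationary and the force lies on the
shell 2, the two balances combine to `∑ |k|⁴ (|k|² - 2) |φₖ|² = 0`, where `û(k) = φₖ k^⊥`. If a mode
off the shell 2 is excited, then so are modes on both sides of it: the shell 1, and a shell `r > 2`.
By the quadratic there are no others. The shell 2 is excited as well, because otherwise the force
does no work while energy is dissipated (`streamCoeff_eq_zero_of_balance`).

Modes outside these shells vanish at all times, so the nonlinear term must vanish there. But some
wave vector outside them is the sum of just one unordered pair of excited modes on different shells,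
and a lone nonparallel pair cannot cancel (`tsum_advectionTerm_ne_zero`,
`not_excited_three_shells`). Hence only the shell 2 is excited. There `B(u, u) = 0`, the equation is
linear, and stationary energy forces `u = g / 2`, a constant (`eq_half_force_of_single_shell`). -/

/-! ### Parseval's identity and uniqueness of Fourier coefficients -/

theorem hasSum_sq_mFourierCoeff_memLp {f : UnitAddTorus (Fin 2) → ℂ} (hf : MemLp f 2 torusMeasure) :
    HasSum (fun k => ‖UnitAddTorus.mFourierCoeff f k‖ ^ 2) (∫ x, ‖f x‖ ^ 2 ∂torusMeasure) := by
  have h : HasSum (fun k => ‖UnitAddTorus.mFourierCoeff (hf.toLp f) k‖ ^ 2)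
      (∫ x, ‖hf.toLp f x‖ ^ 2 ∂torusMeasure) := UnitAddTorus.hasSum_sq_mFourierCoeff (hf.toLp f)
  have h1 : ∀ k, UnitAddTorus.mFourierCoeff (hf.toLp f) k = UnitAddTorus.mFourierCoeff f k :=
    fun k => integral_congr_ae (by
      filter_upwards [hf.coeFn_toLp] with x hx
      rw [hx])
  have h2 : ∫ x, ‖hf.toLp f x‖ ^ 2 ∂torusMeasure = ∫ x, ‖f x‖ ^ 2 ∂torusMeasure :=
    integral_congr_ae (by
      filter_upwards [hf.coeFn_toLp] with x hx
      rw [hx])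
  simpa only [h1, h2] using h

theorem memLp_component (u : PeriodicL2) (i : Fin 2) :
    MemLp (fun x => ((u x i : ℝ) : ℂ)) 2 torusMeasure :=
  ((EuclideanSpace.proj (𝕜 := ℝ) i).comp_memLp' (Lp.memLp u)).ofReal

theorem hasSum_norm_fourierVec_sq (u : PeriodicL2) :
    HasSum (fun k => ‖fourierVec u k‖ ^ 2) (‖u‖ ^ 2) := by
  have h0 := hasSum_sq_mFourierCoeff_memLp (memLp_component u 0)
  have h1 := hasSum_sq_mFourierCoeff_memLp (memLp_component u 1)
  have hi : ∀ i, Integrable (fun x => ‖((u x i : ℝ) : ℂ)‖ ^ 2) torusMeasure := fun i =>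
    (memLp_component u i).integrable_norm_pow (by norm_num)
  have hn : ‖u‖ ^ 2 = ∫ x, ‖((u x 0 : ℝ) : ℂ)‖ ^ 2 ∂torusMeasure
      + ∫ x, ‖((u x 1 : ℝ) : ℂ)‖ ^ 2 ∂torusMeasure := by
    rw [← integral_add (hi 0) (hi 1), ← real_inner_self_eq_norm_sq, L2.inner_def]
    refine integral_congr_ae (Filter.Eventually.of_forall fun x => ?_)
    simp [EuclideanSpace.norm_sq_eq, Fin.sum_univ_two]
  rw [hn]
  refine (h0.add h1).congr_fun fun k => ?_
  simp [EuclideanSpace.norm_sq_eq, Fin.sum_univ_two, fourierVec]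

theorem norm_fourierVec_le (u : PeriodicL2) (k : Fin 2 → ℤ) : ‖fourierVec u k‖ ≤ ‖u‖ := by
  have h := (hasSum_norm_fourierVec_sq u).summable.le_tsum k fun _ _ => by positivity
  rw [(hasSum_norm_fourierVec_sq u).tsum_eq] at h
  exact le_of_sq_le_sq h (norm_nonneg _)

theorem eq_of_fourierVec_eq {u v : PhaseSpace}
    (h : ∀ k, fourierVec (u : PeriodicL2) k = fourierVec (v : PeriodicL2) k) : u = v := by
  have hs := hasSum_norm_fourierVec_sq ((u : PeriodicL2) + (-1 : ℝ) • (v : PeriodicL2))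
  simp only [fourierVec_add, fourierVec_smul, h] at hs
  have h0 : ‖(u : PeriodicL2) + (-1 : ℝ) • (v : PeriodicL2)‖ ^ 2 = 0 :=
    hs.unique (by simp)
  have h1 := norm_eq_zero.1 (pow_eq_zero_iff two_ne_zero |>.1 h0)
  refine Subtype.ext (sub_eq_zero.1 ?_)
  rw [← h1]; module

theorem fourierVec_neg_index (u : PeriodicL2) (k : Fin 2 → ℤ) (i : Fin 2) :
    fourierVec u (-k) i = (starRingEnd ℂ) (fourierVec u k i) := by
  rw [fourierVec_apply, fourierVec_apply, ← integral_conj]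
  refine integral_congr_ae (Filter.Eventually.of_forall fun x => ?_)
  simp [UnitAddTorus.mFourier_neg]

/-! ### Stream function coefficients -/

/-- The coefficient `φₖ` in `û(k) = φₖ k^⊥` with `k^⊥ = (-k₂, k₁)`; up to the factor `i` this is the
Fourier coefficient of the stream function. -/
noncomputable def streamCoeff (u : PhaseSpace) (k : Fin 2 → ℤ) : ℂ :=
  (-(k 1 : ℂ) * fourierVec (u : PeriodicL2) k 0 + (k 0 : ℂ) * fourierVec (u : PeriodicL2) k 1)
    / (waveSq k : ℂ)

theorem waveSq_ne_zero {k : Fin 2 → ℤ} (hk : k ≠ 0) : waveSq k ≠ 0 := by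
  intro h
  apply hk
  have h' : ((k 0) ^ 2 + (k 1) ^ 2 : ℤ) = 0 := by
    unfold waveSq at h
    exact_mod_cast h
  have h0 : k 0 = 0 := by nlinarith [sq_nonneg (k 0), sq_nonneg (k 1)]
  have h1 : k 1 = 0 := by nlinarith [sq_nonneg (k 0), sq_nonneg (k 1)]
  ext i; fin_cases i <;> simp [h0, h1]

theorem waveSq_nonneg (k : Fin 2 → ℤ) : 0 ≤ waveSq k := by unfold waveSq; positivity

theorem waveSq_neg (k : Fin 2 → ℤ) : waveSq (-k) = waveSq k := by simp [waveSq]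

theorem waveSq_cast (k : Fin 2 → ℤ) : (waveSq k : ℂ) = (k 0 : ℂ) ^ 2 + (k 1 : ℂ) ^ 2 := by
  simp [waveSq]

theorem streamCoeff_zero_index (u : PhaseSpace) : streamCoeff u 0 = 0 := by simp [streamCoeff]

theorem fourierVec_eq_streamCoeff (u : PhaseSpace) (k : Fin 2 → ℤ) :
    fourierVec (u : PeriodicL2) k 0 = -(k 1 : ℂ) * streamCoeff u k ∧
      fourierVec (u : PeriodicL2) k 1 = (k 0 : ℂ) * streamCoeff u k := by
  by_cases hk : k = 0
  · subst hk
    simp [u.2.1]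
  · have hw : (waveSq k : ℂ) ≠ 0 := by exact_mod_cast waveSq_ne_zero hk
    have hd := u.2.2 k
    unfold waveDot at hd
    unfold streamCoeff
    constructor
    · field_simp
      rw [waveSq_cast]
      linear_combination (k 0 : ℂ) * hd
    · field_simp
      rw [waveSq_cast]
      linear_combination (k 1 : ℂ) * hd

theorem norm_fourierVec_sq (u : PhaseSpace) (k : Fin 2 → ℤ) :
    ‖fourierVec (u : PeriodicL2) k‖ ^ 2 = waveSq k * ‖streamCoeff u k‖ ^ 2 := by
  obtain ⟨h0, h1⟩ := fourierVec_eq_streamCoeff u k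
  simp only [EuclideanSpace.norm_sq_eq, Fin.sum_univ_two, h0, h1, norm_mul, norm_neg, mul_pow,
    Complex.norm_intCast, waveSq, sq_abs]
  ring

theorem eq_of_streamCoeff_eq {u v : PhaseSpace} (h : ∀ k, streamCoeff u k = streamCoeff v k) :
    u = v := by
  refine eq_of_fourierVec_eq fun k => ?_
  ext i
  fin_cases i
  · simp [(fourierVec_eq_streamCoeff _ k).1, h]
  · simp [(fourierVec_eq_streamCoeff _ k).2, h]

theorem streamCoeff_neg_index (u : PhaseSpace) (k : Fin 2 → ℤ) :
    streamCoeff u (-k) = -(starRingEnd ℂ) (streamCoeff u k) := by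
  simp only [streamCoeff, fourierVec_neg_index, waveSq_neg, map_div₀, map_add, map_mul, map_neg,
    Pi.neg_apply, Complex.conj_ofReal, map_intCast]
  push_cast
  ring

theorem streamCoeff_add (u v : PhaseSpace) (k : Fin 2 → ℤ) :
    streamCoeff (u + v) k = streamCoeff u k + streamCoeff v k := by
  simp only [streamCoeff, Submodule.coe_add, fourierVec_add, PiLp.add_apply]
  ring

theorem streamCoeff_smul (c : ℝ) (u : PhaseSpace) (k : Fin 2 → ℤ) :
    streamCoeff (c • u) k = c * streamCoeff u k := by
  simp only [streamCoeff, Submodule.coe_smul, fourierVec_smul, PiLp.smul_apply, smul_eq_mul]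
  ring

theorem streamCoeff_sub (u v : PhaseSpace) (k : Fin 2 → ℤ) :
    streamCoeff (u - v) k = streamCoeff u k - streamCoeff v k := by
  have h : u - v = u + (-1 : ℝ) • v := by module
  rw [h, streamCoeff_add, streamCoeff_smul]
  push_cast
  ring

theorem norm_streamCoeff_le (u : PhaseSpace) (k : Fin 2 → ℤ) : ‖streamCoeff u k‖ ≤ ‖u‖ := by
  by_cases hk : k = 0
  · rw [hk, streamCoeff_zero_index, norm_zero]; exact norm_nonneg _
  · have h1 : (1 : ℝ) ≤ waveSq k := by
      have h0 : 0 < waveSq k := lt_of_le_of_ne (waveSq_nonneg k) (waveSq_ne_zero hk).symm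
      have h : waveSq k = ((k 0 ^ 2 + k 1 ^ 2 : ℤ) : ℝ) := by simp [waveSq]
      rw [h] at h0 ⊢
      exact_mod_cast Int.cast_pos.1 h0
    have h2 := norm_fourierVec_sq u k
    have h3 : ‖fourierVec (u : PeriodicL2) k‖ ≤ ‖u‖ := norm_fourierVec_le _ k
    refine le_of_sq_le_sq ?_ (norm_nonneg _)
    have h4 := pow_le_pow_left₀ (norm_nonneg _) h3 2
    nlinarith [sq_nonneg ‖streamCoeff u k‖]

/-- `streamCoeff · k` as a continuous real linear map. -/
noncomputable def streamCoeffCLM (k : Fin 2 → ℤ) : PhaseSpace →L[ℝ] ℂ :=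
  LinearMap.mkContinuous
    { toFun := fun u => streamCoeff u k
      map_add' := fun u v => streamCoeff_add u v k
      map_smul' := fun c u => by simp [streamCoeff_smul] } 1
    fun u => by simpa using norm_streamCoeff_le u k

theorem IsStokes.streamCoeff_eq {u v : PhaseSpace} (h : IsStokes u v) (k : Fin 2 → ℤ) :
    streamCoeff v k = waveSq k * streamCoeff u k := by
  simp only [streamCoeff, h k, PiLp.smul_apply, smul_eq_mul]
  ring

/-- `k^⊥ · j`. -/
def waveCross (k j : Fin 2 → ℤ) : ℤ := k 0 * j 1 - k 1 * j 0

/-- Pairing with `k^⊥` removes the Leray projection, which only subtracts a multiple of `k`. The two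
factors come from `(k - j)^⊥ · j = k^⊥ · j` and `j^⊥ · k^⊥ = j · k`. -/
theorem IsInertial.hasSum_streamCoeff {u b : PhaseSpace} (h : IsInertial u u b) (k : Fin 2 → ℤ)
    (hk : k ≠ 0) :
    HasSum (fun j => Complex.I * ((waveCross k j : ℂ) * ((k 0 : ℂ) * j 0 + k 1 * j 1) *
      streamCoeff u (k - j) * streamCoeff u j)) (waveSq k * streamCoeff b k) := by
  have h0 := (EuclideanSpace.proj (𝕜 := ℂ) (0 : Fin 2)).hasSum (h k hk)
  have h1 := (EuclideanSpace.proj (𝕜 := ℂ) (1 : Fin 2)).hasSum (h k hk)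
  have hw : (waveSq k : ℂ) ≠ 0 := by exact_mod_cast waveSq_ne_zero hk
  have h2 := (h0.mul_left (-(k 1 : ℂ))).add (h1.mul_left (k 0 : ℂ))
  have h3 : (waveSq k : ℂ) * streamCoeff b k = -(k 1 : ℂ) * fourierVec (b : PeriodicL2) k 0
      + (k 0 : ℂ) * fourierVec (b : PeriodicL2) k 1 := by
    unfold streamCoeff
    field_simp
  rw [h3]
  refine h2.congr_fun fun j => ?_
  obtain ⟨ha, hb⟩ := fourierVec_eq_streamCoeff u (k - j)
  obtain ⟨hc, hd⟩ := fourierVec_eq_streamCoeff u j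
  simp only [PiLp.proj_apply, inertialTerm, PiLp.smul_apply,
    PiLp.sub_apply, smul_eq_mul, waveDot, waveVec, ha, hb, hc, hd, waveCross, Pi.sub_apply]
  push_cast
  ring

theorem tsum_eq_zero_of_comp_equiv_neg {ι : Type*} (f : ι → ℂ) (e : ι ≃ ι)
    (h : ∀ x, f (e x) = -f x) : ∑' x, f x = 0 := by
  have h1 : ∑' x, f x = -∑' x, f x := by
    conv_lhs => rw [← e.tsum_eq]
    simp only [h, tsum_neg]
  exact self_eq_neg.1 h1

/-! ### Triads, conservation laws and the symmetrized nonlinear term -/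

/-- The summand of the nonlinear term in stream function form. -/
noncomputable def advectionTerm (φ : (Fin 2 → ℤ) → ℂ) (k j : Fin 2 → ℤ) : ℂ :=
  (waveCross k j : ℂ) * ((k 0 : ℂ) * j 0 + k 1 * j 1) * φ (k - j) * φ j

theorem support_advectionTerm_finite {φ : (Fin 2 → ℤ) → ℂ} (hφ : φ.support.Finite)
    (k : Fin 2 → ℤ) : (advectionTerm φ k).support.Finite := by
  refine hφ.subset fun j hj => ?_
  simp only [Function.mem_support, advectionTerm] at hj ⊢
  exact right_ne_zero_of_mul hj

/-- The product of three coefficients whose wave vectors sum to zero. -/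
noncomputable def triad (φ : (Fin 2 → ℤ) → ℂ) (p : (Fin 2 → ℤ) × (Fin 2 → ℤ)) : ℂ :=
  (waveCross p.1 p.2 : ℂ) * φ (p.1 - p.2) * φ p.2 * φ (-p.1)

theorem support_triad_finite {φ : (Fin 2 → ℤ) → ℂ} (hφ : φ.support.Finite) :
    (triad φ).support.Finite := by
  refine ((hφ.neg).prod hφ).subset fun p hp => ?_
  simp only [Function.mem_support, triad] at hp
  refine ⟨?_, ?_⟩
  · simpa using right_ne_zero_of_mul hp
  · simpa using right_ne_zero_of_mul (left_ne_zero_of_mul hp)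

/-- The exchange of the second and the third wave vector of the triad `(k - j, j, -k)`. -/
def triadSwap : (Fin 2 → ℤ) × (Fin 2 → ℤ) ≃ (Fin 2 → ℤ) × (Fin 2 → ℤ) where
  toFun p := (-p.2, -p.1)
  invFun p := (-p.2, -p.1)
  left_inv p := by simp
  right_inv p := by simp

/-- The exchange of the first and the second wave vector of the triad `(k - j, j, -k)`. -/
def triadFlip : (Fin 2 → ℤ) × (Fin 2 → ℤ) ≃ (Fin 2 → ℤ) × (Fin 2 → ℤ) where
  toFun p := (p.1, p.1 - p.2)
  invFun p := (p.1, p.1 - p.2)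
  left_inv p := by simp
  right_inv p := by simp

/-- The exchange of the first and the third wave vector of the triad `(k - j, j, -k)`. -/
def triadTurn : (Fin 2 → ℤ) × (Fin 2 → ℤ) ≃ (Fin 2 → ℤ) × (Fin 2 → ℤ) where
  toFun p := (p.2 - p.1, p.2)
  invFun p := (p.2 - p.1, p.2)
  left_inv p := by simp
  right_inv p := by simp

theorem triad_swap (φ : (Fin 2 → ℤ) → ℂ) (p) : triad φ (triadSwap p) = -triad φ p := by
  have h : -p.2 - -p.1 = p.1 - p.2 := by abel
  simp only [triad, triadSwap, Equiv.coe_fn_mk, waveCross, neg_neg, h, Pi.neg_apply]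
  push_cast
  ring

theorem triad_flip (φ : (Fin 2 → ℤ) → ℂ) (p) : triad φ (triadFlip p) = -triad φ p := by
  simp only [triad, triadFlip, Equiv.coe_fn_mk, waveCross, sub_sub_cancel, Pi.sub_apply]
  push_cast
  ring

theorem triad_turn (φ : (Fin 2 → ℤ) → ℂ) (p) : triad φ (triadTurn p) = -triad φ p := by
  have h : p.2 - p.1 - p.2 = -p.1 := by abel
  simp only [triad, triadTurn, Equiv.coe_fn_mk, waveCross, h, neg_sub, Pi.sub_apply]
  push_cast
  ring

theorem sum_weight_mul_tsum_advectionTerm {φ : (Fin 2 → ℤ) → ℂ} (hφ : φ.support.Finite)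
    (W : (Fin 2 → ℤ) → ℂ) (S : Finset (Fin 2 → ℤ)) (hS : ∀ k ∉ S, φ (-k) = 0) :
    ∑ k ∈ S, W k * φ (-k) * ∑' j, advectionTerm φ k j =
      ∑' p : (Fin 2 → ℤ) × (Fin 2 → ℤ),
        W p.1 * ((p.1 0 : ℂ) * p.2 0 + p.1 1 * p.2 1) * triad φ p := by
  have hsum : Summable fun p : (Fin 2 → ℤ) × (Fin 2 → ℤ) =>
      W p.1 * ((p.1 0 : ℂ) * p.2 0 + p.1 1 * p.2 1) * triad φ p :=
    summable_of_hasFiniteSupport ((support_triad_finite hφ).subset fun p hp =>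
      right_ne_zero_of_mul hp)
  rw [hsum.tsum_prod, tsum_eq_sum (s := S)]
  · refine Finset.sum_congr rfl fun k _ => ?_
    rw [← tsum_mul_left]
    refine tsum_congr fun j => ?_
    simp only [advectionTerm, triad]
    ring
  · intro k hk
    simp [triad, hS k hk]

/-- The nonlinear term conserves the energy. -/
theorem sum_conj_mul_tsum_advectionTerm {φ : (Fin 2 → ℤ) → ℂ} (hφ : φ.support.Finite)
    (S : Finset (Fin 2 → ℤ)) (hS : ∀ k ∉ S, φ (-k) = 0) :
    ∑ k ∈ S, φ (-k) * ∑' j, advectionTerm φ k j = 0 := by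
  have h := sum_weight_mul_tsum_advectionTerm hφ (fun _ => 1) S hS
  simp only [one_mul] at h
  rw [h]
  -- The weight `k · j` is invariant under `(k, j) ↦ (-j, -k)`, while the triad product changes
  -- sign.
  refine tsum_eq_zero_of_comp_equiv_neg _ triadSwap fun p => ?_
  rw [triad_swap]
  simp only [triadSwap, Equiv.coe_fn_mk, Pi.neg_apply]
  push_cast
  ring

/-- The nonlinear term conserves the enstrophy. -/
theorem sum_waveSq_mul_conj_mul_tsum_advectionTerm {φ : (Fin 2 → ℤ) → ℂ} (hφ : φ.support.Finite)
    (S : Finset (Fin 2 → ℤ)) (hS : ∀ k ∉ S, φ (-k) = 0) :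
    ∑ k ∈ S, (waveSq k : ℂ) * φ (-k) * ∑' j, advectionTerm φ k j = 0 := by
  rw [sum_weight_mul_tsum_advectionTerm hφ (fun k => (waveSq k : ℂ)) S hS]
  have hs : ∀ F : (Fin 2 → ℤ) × (Fin 2 → ℤ) → ℂ, Summable fun p => F p * triad φ p := fun F =>
    summable_of_hasFiniteSupport ((support_triad_finite hφ).subset fun p hp =>
      right_ne_zero_of_mul hp)
  have h1 : ∑' p, (waveSq p.1 ^ 2 : ℂ) * triad φ p = 0 :=
    tsum_eq_zero_of_comp_equiv_neg _ triadFlip fun p => by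
      rw [triad_flip]
      simp only [triadFlip, Equiv.coe_fn_mk]
      ring
  have h2 : ∑' p, (waveSq p.1 * waveSq p.2 : ℂ) * triad φ p = 0 :=
    tsum_eq_zero_of_comp_equiv_neg _ triadSwap fun p => by
      rw [triad_swap]
      simp only [triadSwap, Equiv.coe_fn_mk, waveSq_neg]
      ring
  have h3 : ∑' p, (waveSq p.1 * waveSq (p.1 - p.2) : ℂ) * triad φ p = 0 :=
    tsum_eq_zero_of_comp_equiv_neg _ triadTurn fun p => by
      have h : p.2 - p.1 - p.2 = -p.1 := by abel
      rw [triad_turn]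
      simp only [triadTurn, Equiv.coe_fn_mk, h, waveSq_neg, ← waveSq_neg (p.2 - p.1), neg_sub]
      ring
  -- From `2 k · j = |k|² + |j|² - |k - j|²`; each of the three resulting weights is invariant under
  -- one transposition of the triad.
  have h4 : ∀ p : (Fin 2 → ℤ) × (Fin 2 → ℤ),
      (waveSq p.1 : ℂ) * ((p.1 0 : ℂ) * p.2 0 + p.1 1 * p.2 1) * triad φ p =
      (1 / 2) * ((waveSq p.1 ^ 2 : ℂ) * triad φ p) +
      (1 / 2) * ((waveSq p.1 * waveSq p.2 : ℂ) * triad φ p) -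
      (1 / 2) * ((waveSq p.1 * waveSq (p.1 - p.2) : ℂ) * triad φ p) := fun p => by
    simp only [waveSq_cast, Pi.sub_apply]
    push_cast
    ring
  simp only [h4]
  rw [Summable.tsum_sub (((hs _).mul_left _).add ((hs _).mul_left _)) ((hs _).mul_left _),
    Summable.tsum_add ((hs _).mul_left _) ((hs _).mul_left _), tsum_mul_left, tsum_mul_left,
    tsum_mul_left, h1, h2, h3]
  simp

/-- The symmetrized form of the nonlinear term. -/
theorem two_mul_tsum_advectionTerm {φ : (Fin 2 → ℤ) → ℂ} (hφ : φ.support.Finite)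
    (k : Fin 2 → ℤ) :
    2 * ∑' j, advectionTerm φ k j =
      ∑' j, (waveCross k j : ℂ) * (waveSq j - waveSq (k - j)) * φ (k - j) * φ j := by
  have hs : Summable (advectionTerm φ k) :=
    summable_of_hasFiniteSupport (support_advectionTerm_finite hφ k)
  have h1 := (Equiv.subLeft k).tsum_eq (advectionTerm φ k)
  have hs1 : Summable fun j => advectionTerm φ k (Equiv.subLeft k j) :=
    (Equiv.subLeft k).summable_iff.2 hs
  rw [two_mul]
  -- The second copy of the sum is reindexed by `j ↦ k - j`. The cross product changes sign, and `k
  -- · j - k · (k - j) = |j|² - |k - j|²`.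
  nth_rewrite 2 [← h1]
  rw [← hs.tsum_add hs1]
  refine tsum_congr fun j => ?_
  simp only [advectionTerm, Equiv.subLeft_apply, sub_sub_cancel, waveCross, waveSq_cast,
    Pi.sub_apply]
  push_cast
  ring

/-- If only one unordered pair of excited modes from different shells sums to `k`, and its cross
product is nonzero, then the nonlinear term does not vanish at `k`. -/
theorem tsum_advectionTerm_ne_zero {φ : (Fin 2 → ℤ) → ℂ} (hφ : φ.support.Finite)
    {a b : Fin 2 → ℤ} (ha : φ a ≠ 0) (hb : φ b ≠ 0) (hab : waveSq a ≠ waveSq b)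
    (hcross : waveCross a b ≠ 0)
    (h : ∀ j l, φ j ≠ 0 → φ l ≠ 0 → j + l = a + b → waveSq j ≠ waveSq l → j = a ∨ j = b) :
    ∑' j, advectionTerm φ (a + b) j ≠ 0 := by
  intro h0
  have hne : a ≠ b := fun he => hab (by rw [he])
  have h2 := two_mul_tsum_advectionTerm hφ (a + b)
  rw [h0, mul_zero, tsum_eq_sum (s := {a, b}), Finset.sum_pair hne] at h2
  · rw [add_sub_cancel_left, add_sub_cancel_right] at h2
    -- The terms `j = a` and `j = b` are equal, both sign changes cancelling, so they add up.
    have h3 : 2 * ((waveCross a b : ℂ) * (waveSq b - waveSq a) * φ a * φ b) = 0 := by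
      rw [h2]
      simp only [waveCross, Pi.add_apply]
      push_cast
      ring
    have hw : (waveSq b : ℂ) - waveSq a ≠ 0 := by
      rw [sub_ne_zero]; exact_mod_cast hab.symm
    have hc : (waveCross a b : ℂ) ≠ 0 := by exact_mod_cast hcross
    exact (mul_ne_zero two_ne_zero (mul_ne_zero (mul_ne_zero (mul_ne_zero hc hw) ha) hb)) h3
  · intro j hj
    by_contra hn
    have hj' : φ j ≠ 0 := right_ne_zero_of_mul hn
    have hl : φ (a + b - j) ≠ 0 := right_ne_zero_of_mul (left_ne_zero_of_mul hn)
    refine hj ?_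
    have hw : waveSq j ≠ waveSq (a + b - j) := fun he => hn (by rw [← he]; simp)
    simpa using h j (a + b - j) hj' hl (by abel) hw

/-! ### Arithmetic of wave vectors -/

/-- `|k|²` as an integer. -/
def intWaveSq (k : Fin 2 → ℤ) : ℤ := k 0 ^ 2 + k 1 ^ 2

theorem waveSq_eq_intCast (k : Fin 2 → ℤ) : waveSq k = (intWaveSq k : ℝ) := by
  simp [waveSq, intWaveSq]

theorem intWaveSq_neg (k : Fin 2 → ℤ) : intWaveSq (-k) = intWaveSq k := by simp [intWaveSq]

theorem abs_eq_one_of_intWaveSq_eq_two {v : Fin 2 → ℤ} (hv : intWaveSq v = 2) :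
    (v 0 = 1 ∨ v 0 = -1) ∧ (v 1 = 1 ∨ v 1 = -1) := by
  unfold intWaveSq at hv
  have h0 : v 0 ≤ 1 := by nlinarith [sq_nonneg (v 1)]
  have h0' : -1 ≤ v 0 := by nlinarith [sq_nonneg (v 1)]
  have h1 : v 1 ≤ 1 := by nlinarith [sq_nonneg (v 0)]
  have h1' : -1 ≤ v 1 := by nlinarith [sq_nonneg (v 0)]
  generalize v 0 = x at *
  generalize v 1 = y at *
  interval_cases x <;> interval_cases y <;> simp_all

theorem intWaveSq_ne_three (k : Fin 2 → ℤ) : intWaveSq k ≠ 3 := by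
  intro h
  unfold intWaveSq at h
  have h0 : k 0 ≤ 1 := by nlinarith [sq_nonneg (k 1)]
  have h0' : -1 ≤ k 0 := by nlinarith [sq_nonneg (k 1)]
  have h1 : k 1 ≤ 1 := by nlinarith [sq_nonneg (k 0)]
  have h1' : -1 ≤ k 1 := by nlinarith [sq_nonneg (k 0)]
  generalize k 0 = x at *
  generalize k 1 = y at *
  interval_cases x <;> interval_cases y <;> simp_all

theorem intWaveSq_emod_two (k : Fin 2 → ℤ) : intWaveSq k % 2 = (k 0 + k 1) % 2 := by
  have h : ∀ x : ℤ, x ^ 2 % 2 = x % 2 := fun x => by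
    rcases Int.emod_two_eq_zero_or_one x with h | h <;> simp [pow_two, Int.mul_emod, h]
  unfold intWaveSq
  have h0 := h (k 0)
  have h1 := h (k 1)
  omega

/-- Modulo 2, `|k|²` agrees with `k₁ + k₂`, which is additive in `k`. -/
theorem intWaveSq_add_emod_two {a b c d : Fin 2 → ℤ} (h : a + b = c + d) :
    (intWaveSq a + intWaveSq b) % 2 = (intWaveSq c + intWaveSq d) % 2 := by
  have ha := intWaveSq_emod_two a
  have hb := intWaveSq_emod_two b
  have hc := intWaveSq_emod_two c
  have hd := intWaveSq_emod_two d
  have h0 := congrFun h 0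
  have h1 := congrFun h 1
  simp only [Pi.add_apply] at h0 h1
  omega

/-- The parallelogram law, with `|j - l|² ≥ 0` dropped. -/
theorem intWaveSq_add_le (j l : Fin 2 → ℤ) :
    intWaveSq (j + l) ≤ 2 * (intWaveSq j + intWaveSq l) := by
  simp only [intWaveSq, Pi.add_apply]
  nlinarith [sq_nonneg (j 0 - l 0), sq_nonneg (j 1 - l 1)]

theorem eq_of_intWaveSq_add {j l : Fin 2 → ℤ}
    (h : intWaveSq (j + l) = 2 * (intWaveSq j + intWaveSq l)) : j = l := by
  simp only [intWaveSq, Pi.add_apply] at h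
  have h0 : j 0 - l 0 = 0 := by nlinarith [sq_nonneg (j 0 - l 0), sq_nonneg (j 1 - l 1)]
  have h1 : j 1 - l 1 = 0 := by nlinarith [sq_nonneg (j 0 - l 0), sq_nonneg (j 1 - l 1)]
  ext i
  fin_cases i
  · exact sub_eq_zero.1 h0
  · exact sub_eq_zero.1 h1

/-- `k · j`. -/
def intWaveDot (k j : Fin 2 → ℤ) : ℤ := k 0 * j 0 + k 1 * j 1

theorem intWaveSq_add (j l : Fin 2 → ℤ) :
    intWaveSq (j + l) = intWaveSq j + intWaveSq l + 2 * intWaveDot j l := by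
  simp only [intWaveSq, intWaveDot, Pi.add_apply]
  ring

/-- If `j ≠ v`, then `v · l = v · k + (2 - v · j)` exceeds `v · k`, so maximality makes `l` parallel
to `v`. For `j = -v` this contradicts `v × l = v × k ≠ 0`. For `j ⊥ v`, equality of `|k|` and `|l|`
then puts `k` on the shell 2, against `r > 2`. -/
theorem eq_of_add_eq_add_of_extremal {r : ℤ} (hr : 2 < r) {v k j l : Fin 2 → ℤ}
    (hv : intWaveSq v = 2) (hj : intWaveSq j = 2) (hk : intWaveSq k = r) (hl : intWaveSq l = r)
    (hsum : j + l = v + k) (hcross : waveCross v k ≠ 0)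
    (hmax : waveCross v l ≠ 0 → intWaveDot v l ≤ intWaveDot v k) : j = v := by
  obtain ⟨hv0, hv1⟩ := abs_eq_one_of_intWaveSq_eq_two hv
  obtain ⟨hj0, hj1⟩ := abs_eq_one_of_intWaveSq_eq_two hj
  have h0 := congrFun hsum 0
  have h1 := congrFun hsum 1
  simp only [Pi.add_apply] at h0 h1
  have hl0 : l 0 = v 0 + k 0 - j 0 := by omega
  have hl1 : l 1 = v 1 + k 1 - j 1 := by omega
  suffices h : j 0 = v 0 ∧ j 1 = v 1 by
    ext i
    fin_cases i
    · exact h.1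
    · exact h.2
  -- Half of `|k + v - j|² - |k|² = 0`.
  have hlin : 2 - v 0 * j 0 - v 1 * j 1 + k 0 * (v 0 - j 0) + k 1 * (v 1 - j 1) = 0 := by
    unfold intWaveSq at hv hj hk hl
    rw [hl0, hl1] at hl
    nlinarith
  unfold waveCross at hcross hmax
  unfold intWaveDot at hmax
  unfold intWaveSq at hk
  rw [hl0, hl1] at hmax
  clear hv hj hl hsum hl0 hl1 h0 h1
  generalize k 0 = x at *
  generalize k 1 = y at *
  by_contra hne
  have hsmall : ¬ (x ^ 2 ≤ 1 ∧ y ^ 2 ≤ 1) := fun h => by linarith [h.1, h.2]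
  have hxy : ¬ ((x = 1 ∨ x = -1) ∧ (y = 1 ∨ y = -1)) := by
    rintro ⟨rfl | rfl, rfl | rfl⟩ <;> norm_num at hsmall
  clear hk hsmall
  rcases hv0 with hv0 | hv0 <;> rcases hv1 with hv1 | hv1 <;> rcases hj0 with hj0 | hj0 <;>
    rcases hj1 with hj1 | hj1 <;> simp only [hv0, hv1, hj0, hj1, and_self, not_true_eq_false] at * <;> omega

/-- A line through the origin meets a circle centred there in at most two opposite points. -/
theorem eq_or_eq_neg_of_parallel {v k l : Fin 2 → ℤ} (hv : intWaveSq v = 2)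
    (hk : waveCross v k = 0) (hl : waveCross v l = 0) (hkl : intWaveSq k = intWaveSq l) :
    l = k ∨ l = -k := by
  obtain ⟨hv0, hv1⟩ := abs_eq_one_of_intWaveSq_eq_two hv
  unfold waveCross at hk hl
  unfold intWaveSq at hkl
  have hk1 : k 1 ^ 2 = k 0 ^ 2 := by
    rcases hv0 with hv0 | hv0 <;> rcases hv1 with hv1 | hv1 <;> rw [hv0, hv1] at hk <;>
      exact sq_eq_sq_iff_eq_or_eq_neg.2 (by omega)
  have hl1 : l 1 ^ 2 = l 0 ^ 2 := by
    rcases hv0 with hv0 | hv0 <;> rcases hv1 with hv1 | hv1 <;> rw [hv0, hv1] at hl <;>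
      exact sq_eq_sq_iff_eq_or_eq_neg.2 (by omega)
  have h0 : l 0 ^ 2 = k 0 ^ 2 := by linarith
  have hext : ∀ a b : Fin 2 → ℤ, a 0 = b 0 → a 1 = b 1 → a = b := fun a b h0 h1 => by
    ext i
    fin_cases i
    · exact h0
    · exact h1
  rcases sq_eq_sq_iff_eq_or_eq_neg.1 h0 with h | h
  · left
    refine hext _ _ h ?_
    rcases hv0 with hv0 | hv0 <;> rcases hv1 with hv1 | hv1 <;> rw [hv0, hv1] at hk hl <;> omega
  · right
    refine hext _ _ h ?_
    simp only [Pi.neg_apply]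
    rcases hv0 with hv0 | hv0 <;> rcases hv1 with hv1 | hv1 <;> rw [hv0, hv1] at hk hl <;> omega

/-! ### Three excited shells generate a new mode -/

/-- A field excited on exactly three shells `|k|² = 1, 2, r` with `r > 2` generates modes outside of
these shells. -/
theorem not_excited_three_shells {φ : (Fin 2 → ℤ) → ℂ} (hφ : φ.support.Finite)
    (hneg : ∀ k, φ k ≠ 0 → φ (-k) ≠ 0) {r : ℤ} (hr : 2 < r)
    (hsupp : ∀ k, φ k ≠ 0 → intWaveSq k = 1 ∨ intWaveSq k = 2 ∨ intWaveSq k = r)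
    (hN : ∀ k, intWaveSq k ≠ 1 → intWaveSq k ≠ 2 → intWaveSq k ≠ r →
      ∑' j, advectionTerm φ k j = 0)
    {e v k : Fin 2 → ℤ} (he : φ e ≠ 0) (he1 : intWaveSq e = 1) (hv : φ v ≠ 0)
    (hv2 : intWaveSq v = 2) (hk : φ k ≠ 0) (hkr : intWaveSq k = r) : False := by
  have hr4 : 4 ≤ r := by
    have := intWaveSq_ne_three k
    omega
  have hpair : ∀ j l, φ j ≠ 0 → φ l ≠ 0 → waveSq j ≠ waveSq l → intWaveSq j ≠ intWaveSq l :=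
    fun j l _ _ h h' => h (by rw [waveSq_eq_intCast, waveSq_eq_intCast, h'])
  -- If all modes on the shell `r` are parallel to `v`, the lone pair is taken from the shells 1 and
  -- `r`; otherwise from the shells 2 and `r`.
  by_cases hpar : ∀ l, φ l ≠ 0 → intWaveSq l = r → waveCross v l = 0
  · obtain ⟨k, hk, hkr, hek⟩ : ∃ k, φ k ≠ 0 ∧ intWaveSq k = r ∧ 0 ≤ intWaveDot e k := by
      rcases le_total 0 (intWaveDot e k) with h | h
      · exact ⟨k, hk, hkr, h⟩
      · refine ⟨-k, hneg k hk, by rw [intWaveSq_neg, hkr], ?_⟩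
        simp only [intWaveDot, Pi.neg_apply] at h ⊢
        linarith
    have hvk := hpar k hk hkr
    obtain ⟨hv0, hv1⟩ := abs_eq_one_of_intWaveSq_eq_two hv2
    have hk1 : k 1 ^ 2 = k 0 ^ 2 := by
      unfold waveCross at hvk
      rcases hv0 with hv0 | hv0 <;> rcases hv1 with hv1 | hv1 <;> rw [hv0, hv1] at hvk <;>
        exact sq_eq_sq_iff_eq_or_eq_neg.2 (by omega)
    -- A multiple of the diagonal vector `v` has `|k|² = 2 m²`, and `r > 2` gives `|m| ≥ 2`.
    have hr8 : 8 ≤ r := by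
      have hr2 : r = 2 * k 0 ^ 2 := by rw [← hkr, intWaveSq, hk1]; ring
      by_contra hlt
      have h1 : k 0 ≤ 1 := by nlinarith
      have h2 : -1 ≤ k 0 := by nlinarith
      have h3 : k 0 ^ 2 ≤ 1 := by nlinarith
      linarith
    have hK : intWaveSq (e + k) = 1 + r + 2 * intWaveDot e k := by
      rw [intWaveSq_add, he1, hkr]
    have hcross : waveCross e k ≠ 0 := by
      intro h
      have h2 : waveCross e k ^ 2 = k 0 ^ 2 := by
        have hne : e 0 * e 1 = 0 := by
          unfold intWaveSq at he1
          have h0 : e 0 ≤ 1 := by nlinarith [sq_nonneg (e 1)]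
          have h0' : -1 ≤ e 0 := by nlinarith [sq_nonneg (e 1)]
          generalize e 0 = x at *
          interval_cases x <;> simp_all
        have : waveCross e k ^ 2 =
            e 0 ^ 2 * k 1 ^ 2 + e 1 ^ 2 * k 0 ^ 2 - 2 * (e 0 * e 1) * k 0 * k 1 := by
          unfold waveCross; ring
        rw [this, hne, hk1]
        unfold intWaveSq at he1
        linear_combination k 0 ^ 2 * he1
      rw [h] at h2
      unfold intWaveSq at hkr
      nlinarith
    have hfinal : ∀ j l, φ l ≠ 0 → j + l = e + k → intWaveSq j = 1 → intWaveSq l = r →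
        l = k := by
      intro j l hl hsum hj hlr
      rcases eq_or_eq_neg_of_parallel hv2 hvk (hpar l hl hlr) (by rw [hkr, hlr]) with h | h
      · exact h
      -- Here `l = -k` would give `j = e + 2k`, with `|j|² = 1 + 4r + 4 e · k > 1`.
      · exfalso
        have hj' : j = e + k + k := by rw [← hsum, h]; abel
        have h3 := intWaveSq_add (e + k) k
        rw [← hj', hK, hj, hkr] at h3
        have h4 : intWaveDot (e + k) k = intWaveDot e k + r := by
          rw [← hkr]; simp only [intWaveDot, intWaveSq, Pi.add_apply]; ring
        linarith
    refine tsum_advectionTerm_ne_zero hφ he hk ?_ hcross ?_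
      (hN (e + k) (by omega) (by omega) (by omega))
    · rw [waveSq_eq_intCast, waveSq_eq_intCast, he1, hkr]
      exact_mod_cast (by omega : (1 : ℤ) ≠ r)
    · intro j l hj hl hsum hw
      have hw' := hpair j l hj hl hw
      have hle := intWaveSq_add_le j l
      rw [hsum, hK] at hle
      have hmod := intWaveSq_add_emod_two hsum
      rw [he1, hkr] at hmod
      -- Shells 1 and 2 give `|j + l|² ≤ 6`, too small as `r ≥ 8`; shells 2 and `r` have the wrong
      -- parity.
      rcases hsupp j hj with h1 | h1 | h1 <;> rcases hsupp l hl with h2 | h2 | h2 <;>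
        rw [h1, h2] at hle hmod hw'
      · omega
      · omega
      · have := hfinal j l hl hsum h1 h2
        subst this
        exact Or.inl (add_right_cancel hsum)
      · omega
      · omega
      · omega
      · exact Or.inr (hfinal l j hj (by rw [add_comm, hsum]) h2 h1)
      · omega
      · omega
  · push Not at hpar
    have hTfin : {l | φ l ≠ 0 ∧ intWaveSq l = r ∧ waveCross v l ≠ 0}.Finite :=
      hφ.subset fun l hl => hl.1
    -- Maximizing `v · k` makes `v + k` extreme, so that it has no second representation by the
    -- shells 2 and `r`. Comparison with `-k` gives `v · k ≥ 0`, hence `|v + k|² > r`.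
    obtain ⟨k, ⟨hk, hkr, hvk⟩, hmax⟩ :=
      Set.exists_max_image _ (intWaveDot v) hTfin hpar
    have hpos : 0 ≤ intWaveDot v k := by
      have h := hmax (-k) ⟨hneg k hk, by rw [intWaveSq_neg, hkr], by
        simp only [waveCross, Pi.neg_apply] at hvk ⊢
        intro h
        exact hvk (by linarith)⟩
      simp only [intWaveDot, Pi.neg_apply] at h ⊢
      linarith
    have hK : intWaveSq (v + k) = 2 + r + 2 * intWaveDot v k := by
      rw [intWaveSq_add, hv2, hkr]
    have hfinal : ∀ j l, φ l ≠ 0 → j + l = v + k → intWaveSq j = 2 → intWaveSq l = r → j = v :=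
      fun j l hl hsum hj hlr => eq_of_add_eq_add_of_extremal hr hv2 hj hkr hlr hsum hvk
        fun hc => hmax l ⟨hl, hlr, hc⟩
    refine tsum_advectionTerm_ne_zero hφ hv hk ?_ hvk ?_
      (hN (v + k) (by omega) (by omega) (by omega))
    · rw [waveSq_eq_intCast, waveSq_eq_intCast, hv2, hkr]
      exact_mod_cast (by omega : (2 : ℤ) ≠ r)
    · intro j l hj hl hsum hw
      have hw' := hpair j l hj hl hw
      have hle := intWaveSq_add_le j l
      have heq := mt (eq_of_intWaveSq_add (j := j) (l := l)) fun h => hw' (by rw [h])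
      rw [hsum, hK] at hle heq
      have hmod := intWaveSq_add_emod_two hsum
      rw [hv2, hkr] at hmod
      -- Shells 1 and `r` have the wrong parity. Shells 1 and 2 require `2 + r + 2 v · k ≤ 6`, hence
      -- `r = 4`, again the wrong parity.
      rcases hsupp j hj with h1 | h1 | h1 <;> rcases hsupp l hl with h2 | h2 | h2 <;>
        rw [h1, h2] at hle hmod hw' heq
      · omega
      · omega
      · omega
      · omega
      · omega
      · exact Or.inl (hfinal j l hl hsum h1 h2)
      · omega
      · have := hfinal l j hj (by rw [add_comm, hsum]) h2 h1
        subst this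
        exact Or.inr (add_left_cancel ((add_comm l j).trans hsum))
      · omega

/-! ### Energy and enstrophy balances on finitely many modes -/

theorem finite_setOf_waveSq_le (R : ℝ) : {k : Fin 2 → ℤ | waveSq k ≤ R}.Finite := by
  obtain ⟨N, hN⟩ := exists_nat_ge R
  refine (Set.finite_Icc (fun _ => -(N : ℤ)) (fun _ => (N : ℤ))).subset fun k hk => ?_
  have h : intWaveSq k ≤ N := by
    have : (intWaveSq k : ℝ) ≤ N := by rw [← waveSq_eq_intCast]; exact le_trans hk hN
    exact_mod_cast this
  have hi : ∀ i, k i ^ 2 ≤ N := by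
    unfold intWaveSq at h
    intro i
    fin_cases i
    · have := sq_nonneg (k 1)
      simp only [Fin.zero_eta]
      linarith
    · have := sq_nonneg (k 0)
      simp only [Fin.mk_one]
      linarith
  constructor
  · intro i
    have := hi i
    simp only
    by_contra hlt
    nlinarith
  · intro i
    have := hi i
    simp only
    by_contra hlt
    nlinarith

theorem energy_eq_sum (u : PhaseSpace) (S : Finset (Fin 2 → ℤ))
    (hS : ∀ k ∉ S, streamCoeff u k = 0) :
    energy u = (2 * Real.pi) ^ 2 * ∑ k ∈ S, waveSq k * ‖streamCoeff u k‖ ^ 2 := by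
  unfold energy
  congr 1
  have h := (hasSum_norm_fourierVec_sq (u : PeriodicL2)).tsum_eq
  simp only [norm_fourierVec_sq] at h
  rw [tsum_eq_sum (s := S)] at h
  · exact h.symm
  · intro k hk
    simp [hS k hk]

theorem enstrophy_eq_sum (u : PhaseSpace) (S : Finset (Fin 2 → ℤ))
    (hS : ∀ k ∉ S, streamCoeff u k = 0) :
    enstrophy u = (2 * Real.pi) ^ 2 * ∑ k ∈ S, waveSq k ^ 2 * ‖streamCoeff u k‖ ^ 2 := by
  unfold enstrophy
  congr 1
  simp only [norm_fourierVec_sq]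
  rw [tsum_eq_sum (s := S)]
  · refine Finset.sum_congr rfl fun k _ => by ring
  · intro k hk
    simp [hS k hk]

theorem hasDerivAt_streamCoeff {u : ℝ → PhaseSpace} {u' : PhaseSpace} {t : ℝ}
    (h : HasDerivAt u u' t) (k : Fin 2 → ℤ) :
    HasDerivAt (fun s => streamCoeff (u s) k) (streamCoeff u' k) t :=
  (streamCoeffCLM k).hasFDerivAt.comp_hasDerivAt t h

theorem sum_mul_re_eq_zero_of_hasDerivAt {u : ℝ → PhaseSpace} {u' : PhaseSpace} {t : ℝ}
    (hu : HasDerivAt u u' t) (S : Finset (Fin 2 → ℤ)) (W : (Fin 2 → ℤ) → ℝ) {c : ℝ} (hc : c ≠ 0)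
    (h : HasDerivAt (fun s => c * ∑ k ∈ S, W k * ‖streamCoeff (u s) k‖ ^ 2) 0 t) :
    ∑ k ∈ S, W k * ((starRingEnd ℂ) (streamCoeff (u t) k) * streamCoeff u' k).re = 0 := by
  have h1 : HasDerivAt (fun s => c * ∑ k ∈ S, W k * ‖streamCoeff (u s) k‖ ^ 2)
      (c * ∑ k ∈ S, W k * (2 * inner ℝ (streamCoeff (u t) k) (streamCoeff u' k))) t :=
    (HasDerivAt.fun_sum fun k _ =>
      ((hasDerivAt_streamCoeff hu k).norm_sq).const_mul (W k)).const_mul c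
  have h2 := h1.unique h
  have h3 : c * ∑ k ∈ S, W k * (2 * inner ℝ (streamCoeff (u t) k) (streamCoeff u' k)) =
      (c * 2) * ∑ k ∈ S, W k * ((starRingEnd ℂ) (streamCoeff (u t) k) * streamCoeff u' k).re := by
    rw [mul_assoc, Finset.mul_sum (a := (2 : ℝ))]
    refine congrArg _ (Finset.sum_congr rfl fun k _ => ?_)
    rw [Complex.inner, mul_comm (starRingEnd ℂ _)]
    ring
  rw [h3] at h2
  exact (mul_eq_zero.1 h2).resolve_left (by positivity)

theorem IsInertial.waveSq_mul_streamCoeff {u b : PhaseSpace} (h : IsInertial u u b)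
    {k : Fin 2 → ℤ} (hk : k ≠ 0) :
    (waveSq k : ℂ) * streamCoeff b k = Complex.I * ∑' j, advectionTerm (streamCoeff u) k j := by
  rw [← (h.hasSum_streamCoeff k hk).tsum_eq, tsum_mul_left]
  rfl

theorem streamCoeff_neg_ne_zero (u : PhaseSpace) (k : Fin 2 → ℤ) (h : streamCoeff u k ≠ 0) :
    streamCoeff u (-k) ≠ 0 := by
  rw [streamCoeff_neg_index]
  simpa using h

theorem conj_streamCoeff (u : PhaseSpace) (k : Fin 2 → ℤ) :
    (starRingEnd ℂ) (streamCoeff u k) = -streamCoeff u (-k) := by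
  rw [streamCoeff_neg_index, neg_neg]

theorem sum_conj_mul_inertial {u b : PhaseSpace} (h : IsInertial u u b) {S : Finset (Fin 2 → ℤ)}
    (hS : ∀ k ∉ S, streamCoeff u k = 0) :
    ∑ k ∈ S, waveSq k * ((starRingEnd ℂ) (streamCoeff u k) * streamCoeff b k) = 0 ∧
    ∑ k ∈ S, (waveSq k : ℂ) ^ 2 * ((starRingEnd ℂ) (streamCoeff u k) * streamCoeff b k) = 0 := by
  have hfin : (streamCoeff u).support.Finite :=
    S.finite_toSet.subset fun k hk => by
      by_contra hkS
      exact hk (hS k hkS)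
  have hS' : ∀ k ∉ S, streamCoeff u (-k) = 0 := fun k hk => by
    rw [streamCoeff_neg_index, hS k hk]; simp
  have h1 := sum_conj_mul_tsum_advectionTerm hfin S hS'
  have h2 := sum_waveSq_mul_conj_mul_tsum_advectionTerm hfin S hS'
  have key : ∀ k, (waveSq k : ℂ) * ((starRingEnd ℂ) (streamCoeff u k) * streamCoeff b k) =
      -Complex.I * (streamCoeff u (-k) * ∑' j, advectionTerm (streamCoeff u) k j) := by
    intro k
    by_cases hk : k = 0
    · subst hk
      simp [streamCoeff_zero_index]
    · rw [conj_streamCoeff]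
      linear_combination -streamCoeff u (-k) * h.waveSq_mul_streamCoeff hk
  constructor
  · rw [Finset.sum_congr rfl fun k _ => key k, ← Finset.mul_sum, h1, mul_zero]
  · have : ∀ k ∈ S, (waveSq k : ℂ) ^ 2 * ((starRingEnd ℂ) (streamCoeff u k) * streamCoeff b k) =
        -Complex.I * ((waveSq k : ℂ) * streamCoeff u (-k) *
          ∑' j, advectionTerm (streamCoeff u) k j) := fun k _ => by
      linear_combination (waveSq k : ℂ) * key k
    rw [Finset.sum_congr rfl this, ← Finset.mul_sum, h2, mul_zero]

theorem re_conj_mul_rhs (z g b : ℂ) (w : ℝ) :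
    ((starRingEnd ℂ) z * (g - w * z - b)).re =
      ((starRingEnd ℂ) z * g).re - w * ‖z‖ ^ 2 - ((starRingEnd ℂ) z * b).re := by
  rw [Complex.sq_norm, Complex.normSq_apply]
  simp
  ring

/-- The energy and the enstrophy balance of a solution excited on finitely many modes whose energy
and enstrophy are stationary. -/
theorem balance_of_stationary {g : PhaseSpace} {u : ℝ → PhaseSpace} {a b : PhaseSpace} {t : ℝ}
    (ha : IsStokes (u t) a) (hb : IsInertial (u t) (u t) b) (hu : HasDerivAt u (g - a - b) t)
    {S : Finset (Fin 2 → ℤ)} (hS : ∀ s, ∀ k ∉ S, streamCoeff (u s) k = 0)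
    (he : HasDerivAt (fun s => energy (u s)) 0 t)
    (hE : HasDerivAt (fun s => enstrophy (u s)) 0 t) :
    ∑ k ∈ S, waveSq k ^ 2 * ‖streamCoeff (u t) k‖ ^ 2 =
      ∑ k ∈ S, waveSq k * ((starRingEnd ℂ) (streamCoeff (u t) k) * streamCoeff g k).re ∧
    ∑ k ∈ S, waveSq k ^ 3 * ‖streamCoeff (u t) k‖ ^ 2 =
      ∑ k ∈ S, waveSq k ^ 2 * ((starRingEnd ℂ) (streamCoeff (u t) k) * streamCoeff g k).re := by
  have hpi : (2 * Real.pi) ^ 2 ≠ 0 := by positivity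
  simp only [fun s => energy_eq_sum (u s) S (hS s)] at he
  simp only [fun s => enstrophy_eq_sum (u s) S (hS s)] at hE
  have h1 := sum_mul_re_eq_zero_of_hasDerivAt hu S waveSq hpi he
  have h2 := sum_mul_re_eq_zero_of_hasDerivAt hu S (fun k => waveSq k ^ 2) hpi hE
  simp only [streamCoeff_sub, ha.streamCoeff_eq, re_conj_mul_rhs] at h1 h2
  simp only [mul_sub, Finset.sum_sub_distrib] at h1 h2
  obtain ⟨h3, h4⟩ := sum_conj_mul_inertial hb (hS t)
  have h3' : ∑ k ∈ S, waveSq k *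
      ((starRingEnd ℂ) (streamCoeff (u t) k) * streamCoeff b k).re = 0 := by
    have := congrArg Complex.re h3
    simpa only [Complex.re_sum, Complex.re_ofReal_mul, Complex.zero_re] using this
  have h4' : ∑ k ∈ S, waveSq k ^ 2 *
      ((starRingEnd ℂ) (streamCoeff (u t) k) * streamCoeff b k).re = 0 := by
    have := congrArg Complex.re h4
    simpa only [Complex.re_sum, ← Complex.ofReal_pow, Complex.re_ofReal_mul,
      Complex.zero_re] using this
  rw [h3', sub_zero, sub_eq_zero] at h1
  rw [h4', sub_zero, sub_eq_zero] at h2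
  refine ⟨?_, ?_⟩
  · rw [h1]
    exact Finset.sum_congr rfl fun k _ => by ring
  · rw [h2]
    exact Finset.sum_congr rfl fun k _ => by ring

/-! ### Reduction to the shell of the force and conclusion -/

/-- A solution with stationary energy and without modes outside of the shell `|k|² = 2` is
constant. -/
theorem eq_half_force_of_single_shell {g : PhaseSpace} {u : ℝ → PhaseSpace}
    (hsol : IsSolution g u) (he : ∀ t, HasDerivAt (fun s => energy (u s)) 0 t)
    (hfin : ∀ t, (streamCoeff (u t)).support.Finite)
    (hu : ∀ t k, waveSq k ≠ 2 → streamCoeff (u t) k = 0) (t : ℝ) :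
    u t = (1 / 2 : ℝ) • g := by
  have hd : ∀ t, HasDerivAt u (g - (2 : ℝ) • u t) t := by
    intro t
    obtain ⟨a, b, ha, hb, hab⟩ := hsol t
    have ha2 : a = (2 : ℝ) • u t := eq_of_streamCoeff_eq fun k => by
      rw [ha.streamCoeff_eq, streamCoeff_smul]
      by_cases hk : waveSq k = 2
      · rw [hk]
      · rw [hu t k hk, mul_zero, mul_zero]
    have hb0 : b = (0 : ℝ) • b := eq_of_streamCoeff_eq fun k => by
      rw [streamCoeff_smul, Complex.ofReal_zero, zero_mul]
      by_cases hk : k = 0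
      · rw [hk, streamCoeff_zero_index]
      · have hN := two_mul_tsum_advectionTerm (hfin t) k
        have hz : ∀ j, (waveCross k j : ℂ) * (waveSq j - waveSq (k - j)) *
            streamCoeff (u t) (k - j) * streamCoeff (u t) j = 0 := fun j => by
          by_cases h1 : waveSq j = 2
          · by_cases h2 : waveSq (k - j) = 2
            · simp [h1, h2]
            · simp [hu t _ h2]
          · simp [hu t _ h1]
        simp only [hz, tsum_zero, mul_eq_zero, two_ne_zero, false_or] at hN
        have hw := hb.waveSq_mul_streamCoeff hk
        rw [hN, mul_zero, mul_eq_zero] at hw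
        exact hw.resolve_left (by exact_mod_cast waveSq_ne_zero hk)
    rw [zero_smul] at hb0
    rwa [ha2, hb0, sub_zero] at hab
  have hinner : ∀ t, inner ℝ (u t) (g - (2 : ℝ) • u t) = 0 := by
    intro t
    have h1 : HasDerivAt (fun s => energy (u s))
        ((2 * Real.pi) ^ 2 * (2 * inner ℝ (u t) (g - (2 : ℝ) • u t))) t :=
      ((hd t).norm_sq).const_mul _
    have h2 := h1.unique (he t)
    simpa [Real.pi_ne_zero] using h2
  -- Differentiating `⟪u, g - 2u⟫ = 0` with `u' = g - 2u` gives `|g - 2u|² - 2 ⟪u, g - 2u⟫ = 0`, so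
  -- `g = 2u`.
  have h1 := (hd t).inner ℝ (((hd t).const_smul (2 : ℝ)).const_sub g)
  have h2 := h1.unique ((hasDerivAt_const t (0 : ℝ)).congr_of_eventuallyEq
    (Filter.Eventually.of_forall hinner))
  rw [inner_neg_right, inner_smul_right, hinner t, mul_zero, neg_zero, zero_add,
    Pi.smul_apply, inner_self_eq_zero, sub_eq_zero] at h2
  rw [h2, smul_smul]
  norm_num

/-- A state of a solution satisfying the two balances of stationary energy and enstrophy, the
force being in the shell `|k|² = 2`, has no mode outside of that shell if all its modes are in the
set of `k` with `|k|² = 2` or `|k|⁴ = α |k|² + β`, and the nonlinear term generates no other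
modes. -/
theorem streamCoeff_eq_zero_of_balance {g u : PhaseSpace} {S : Finset (Fin 2 → ℤ)}
    (hS : ∀ k ∉ S, streamCoeff u k = 0) (hg : ∀ k, waveSq k ≠ 2 → streamCoeff g k = 0)
    (h1 : ∑ k ∈ S, waveSq k ^ 2 * ‖streamCoeff u k‖ ^ 2 =
      ∑ k ∈ S, waveSq k * ((starRingEnd ℂ) (streamCoeff u k) * streamCoeff g k).re)
    (h2 : ∑ k ∈ S, waveSq k ^ 3 * ‖streamCoeff u k‖ ^ 2 =
      ∑ k ∈ S, waveSq k ^ 2 * ((starRingEnd ℂ) (streamCoeff u k) * streamCoeff g k).re)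
    {α β : ℝ} (hsupp : ∀ k, streamCoeff u k ≠ 0 →
      waveSq k = 2 ∨ waveSq k ^ 2 = α * waveSq k + β)
    (hN : ∀ k, waveSq k ≠ 2 → waveSq k ^ 2 ≠ α * waveSq k + β →
      ∑' j, advectionTerm (streamCoeff u) k j = 0)
    (k : Fin 2 → ℤ) (hk : waveSq k ≠ 2) : streamCoeff u k = 0 := by
  by_contra hk0
  have hfin : (streamCoeff u).support.Finite :=
    S.finite_toSet.subset fun k hk => by
      by_contra hkS
      exact hk (hS k hkS)
  have hmem : ∀ k, streamCoeff u k ≠ 0 → k ∈ S := fun k hk => by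
    by_contra hkS
    exact hk (hS k hkS)
  have hpos : ∀ k, streamCoeff u k ≠ 0 → 1 ≤ intWaveSq k := fun k hk => by
    have hk0 : k ≠ 0 := fun h => hk (by rw [h, streamCoeff_zero_index])
    have h3 := waveSq_nonneg k
    have h4 := waveSq_ne_zero hk0
    rw [waveSq_eq_intCast] at h3 h4
    have h3' : 0 ≤ intWaveSq k := by exact_mod_cast h3
    have h4' : intWaveSq k ≠ 0 := by exact_mod_cast h4
    omega
  -- On the support of the force `|k|² = 2`, so the right side of the enstrophy balance is twice
  -- that of the energy balance.
  have hE : ∑ k ∈ S, waveSq k ^ 2 * (waveSq k - 2) * ‖streamCoeff u k‖ ^ 2 = 0 := by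
    have h3 : ∑ k ∈ S, waveSq k ^ 2 * ((starRingEnd ℂ) (streamCoeff u k) * streamCoeff g k).re =
        2 * ∑ k ∈ S, waveSq k * ((starRingEnd ℂ) (streamCoeff u k) * streamCoeff g k).re := by
      rw [Finset.mul_sum]
      refine Finset.sum_congr rfl fun k _ => ?_
      by_cases hk : waveSq k = 2
      · rw [hk]; ring
      · simp [hg k hk]
    rw [h3, ← h1, Finset.mul_sum] at h2
    rw [← sub_eq_zero, ← Finset.sum_sub_distrib] at h2
    rw [← h2]
    exact Finset.sum_congr rfl fun k _ => by ring
  have hterm : ∀ k, waveSq k ≠ 2 → streamCoeff u k ≠ 0 →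
      waveSq k ^ 2 * (waveSq k - 2) * ‖streamCoeff u k‖ ^ 2 ≠ 0 := fun k hk hk0 => by
    have h3 : waveSq k ≠ 0 := by
      have := hpos k hk0
      rw [waveSq_eq_intCast]
      exact_mod_cast (by omega : intWaveSq k ≠ 0)
    exact mul_ne_zero (mul_ne_zero (pow_ne_zero 2 h3) (sub_ne_zero.2 hk))
      (pow_ne_zero 2 (norm_ne_zero_iff.2 hk0))
  -- Without the shell 1 all terms of `hE` are nonnegative, hence zero, against the mode `k`. The
  -- shell above 2 is obtained in the same way with nonpositive terms.
  obtain ⟨e, he, he1⟩ : ∃ e, streamCoeff u e ≠ 0 ∧ intWaveSq e = 1 := by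
    by_contra! hno
    refine hterm k hk hk0 ((Finset.sum_eq_zero_iff_of_nonneg fun l _ => ?_).1 hE k (hmem k hk0))
    by_cases hl : streamCoeff u l = 0
    · simp [hl]
    · have h3 := hpos l hl
      have h4 := hno l hl
      have h5 : (2 : ℝ) ≤ waveSq l := by
        rw [waveSq_eq_intCast]
        exact_mod_cast (by omega : 2 ≤ intWaveSq l)
      have h6 : 0 ≤ waveSq l - 2 := by linarith
      positivity
  have hwe : waveSq e = 1 := by rw [waveSq_eq_intCast, he1]; norm_num
  obtain ⟨l, hl, hl2⟩ : ∃ l, streamCoeff u l ≠ 0 ∧ 2 < intWaveSq l := by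
    by_contra! hno
    refine hterm e (by rw [hwe]; norm_num) he
      ((Finset.sum_eq_zero_iff_of_nonpos fun l _ => ?_).1 hE e (hmem e he))
    by_cases hl : streamCoeff u l = 0
    · simp [hl]
    · have h5 : waveSq l ≤ 2 := by
        rw [waveSq_eq_intCast]
        exact_mod_cast hno l hl
      exact mul_nonpos_of_nonpos_of_nonneg
        (mul_nonpos_of_nonneg_of_nonpos (sq_nonneg _) (by linarith)) (sq_nonneg _)
  -- Without the shell 2 the force does no work, and the energy balance annihilates every mode.
  obtain ⟨v, hv, hv2⟩ : ∃ v, streamCoeff u v ≠ 0 ∧ intWaveSq v = 2 := by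
    by_contra! hno
    have h3 : ∑ k ∈ S, waveSq k * ((starRingEnd ℂ) (streamCoeff u k) * streamCoeff g k).re = 0 :=
      Finset.sum_eq_zero fun k _ => by
        by_cases hk : streamCoeff u k = 0
        · simp [hk]
        · have h4 : waveSq k ≠ 2 := by
            rw [waveSq_eq_intCast]
            exact_mod_cast hno k hk
          simp [hg k h4]
    rw [h3] at h1
    have h4 := (Finset.sum_eq_zero_iff_of_nonneg fun l _ => by positivity).1 h1 e (hmem e he)
    rw [hwe] at h4
    simp [he] at h4
  have hroot : ∀ x : ℝ, x ^ 2 = α * x + β ↔ x = 1 ∨ x = intWaveSq l := by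
    have hr : (2 : ℝ) < intWaveSq l := by exact_mod_cast hl2
    have h3 := (hsupp e he).resolve_left (by rw [hwe]; norm_num)
    have h4 := (hsupp l hl).resolve_left (by rw [waveSq_eq_intCast]; exact hr.ne')
    rw [hwe] at h3
    rw [waveSq_eq_intCast] at h4
    -- Vieta's formulas for the roots 1 and `r`.
    have hα : α = intWaveSq l + 1 := by
      have : ((intWaveSq l : ℝ) - 1) * (α - (intWaveSq l + 1)) = 0 := by
        linear_combination h3 - h4
      exact sub_eq_zero.1 ((mul_eq_zero.1 this).resolve_left (by linarith))
    have hβ : β = -intWaveSq l := by linarith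
    intro x
    have : x ^ 2 = α * x + β ↔ (x - 1) * (x - intWaveSq l) = 0 := by
      rw [hα, hβ, ← sub_eq_zero]
      ring_nf
    rw [this, mul_eq_zero, sub_eq_zero, sub_eq_zero]
  refine not_excited_three_shells hfin (streamCoeff_neg_ne_zero u) hl2 (fun k hk => ?_)
    (fun k h3 h4 h5 => hN k ?_ ?_) he he1 hv hv2 hl rfl
  · have h3 := hsupp k hk
    rw [hroot, waveSq_eq_intCast] at h3
    have h4 : intWaveSq k = 2 ∨ intWaveSq k = 1 ∨ intWaveSq k = intWaveSq l := by
      exact_mod_cast h3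
    tauto
  · rw [waveSq_eq_intCast]
    exact_mod_cast h4
  · rw [Ne, hroot, waveSq_eq_intCast]
    rintro (h | h)
    · exact h3 (by exact_mod_cast h)
    · exact h5 (by exact_mod_cast h)

theorem mainTheorem1 (g : PhaseSpace) (hg : g ≠ 0) (hAg : IsStokes g ((2 : ℝ) • g)) :
    ¬ ∃ u : ℝ → PhaseSpace, IsChainedGhostSolution g u := by
  rintro ⟨u, hghost, γ, β, α, hchain⟩
  have hg2 : ∀ k, waveSq k ≠ 2 → streamCoeff g k = 0 := fun k hk => by
    have h := hAg.streamCoeff_eq k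
    rw [streamCoeff_smul] at h
    have h' : ((waveSq k : ℂ) - 2) * streamCoeff g k = 0 := by
      push_cast at h
      linear_combination -h
    refine (mul_eq_zero.1 h').resolve_left ?_
    rw [sub_eq_zero]
    exact_mod_cast hk
  have hsupp : ∀ t k, waveSq k ≠ 2 → waveSq k ^ 2 ≠ α * waveSq k + β →
      streamCoeff (u t) k = 0 := fun t k hk hk' => by
    obtain ⟨a, ha, ha2⟩ := hchain t
    have h := ha2.streamCoeff_eq k
    rw [streamCoeff_add, streamCoeff_add, streamCoeff_smul, streamCoeff_smul, streamCoeff_smul,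
      ha.streamCoeff_eq, hg2 k hk] at h
    have h' : ((waveSq k : ℂ) ^ 2 - (α * waveSq k + β)) * streamCoeff (u t) k = 0 := by
      linear_combination -h
    refine (mul_eq_zero.1 h').resolve_left ?_
    rw [sub_eq_zero]
    exact_mod_cast hk'
  -- If `x > |α| + |β| + 2`, then `x² > |α| x + |β| ≥ α x + β`, so no root lies beyond this bound.
  set S := (finite_setOf_waveSq_le (|α| + |β| + 2)).toFinset
  have hS : ∀ t, ∀ k ∉ S, streamCoeff (u t) k = 0 := fun t k hk => by
    have hk' : |α| + |β| + 2 < waveSq k := by simpa [S] using hk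
    have hα := abs_nonneg α
    have hβ := abs_nonneg β
    refine hsupp t k (by linarith) fun h => ?_
    nlinarith [le_abs_self α, le_abs_self β]
  have hshell : ∀ t k, waveSq k ≠ 2 → streamCoeff (u t) k = 0 := fun t => by
    obtain ⟨a, b, ha, hb, hab⟩ := hghost.isSolution t
    obtain ⟨h1, h2⟩ := balance_of_stationary ha hb hab hS (hghost.energy_deriv t)
      (hghost.enstrophy_deriv t)
    refine streamCoeff_eq_zero_of_balance (α := α) (β := β) (hS t) hg2 h1 h2 (fun k hk => ?_)
      fun k hk hk' => ?_
    · by_contra! h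
      exact hk (hsupp t k h.1 h.2)
    · by_cases hk0 : k = 0
      · subst hk0
        simp [advectionTerm, waveCross]
      -- The mode `k` is zero at all times, so its time derivative vanishes; the force and the
      -- Stokes term vanish there too, leaving only the nonlinear term.
      have h3 := (hasDerivAt_streamCoeff hab k).unique
        ((hasDerivAt_const t (0 : ℂ)).congr_of_eventuallyEq
          (Filter.Eventually.of_forall fun s => hsupp s k hk hk'))
      rw [streamCoeff_sub, streamCoeff_sub, hg2 k hk, ha.streamCoeff_eq, hsupp t k hk hk',
        mul_zero, sub_zero, zero_sub, neg_eq_zero] at h3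
      have h4 := hb.waveSq_mul_streamCoeff hk0
      rw [h3, mul_zero] at h4
      exact (mul_eq_zero.1 h4.symm).resolve_left Complex.I_ne_zero
  refine hghost.nonstationary ⟨(1 / 2 : ℝ) • g, eq_half_force_of_single_shell hghost.isSolution
    hghost.energy_deriv (fun t => S.finite_toSet.subset fun k hk => ?_) hshell⟩
  by_contra hkS
  exact hk (hS t k hkS)
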